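/- For a morphism of schemes $f : X \to S$, let $\mathrm{QRel}(f)$ (resp. $\mathrm{Rel}(f)$) be the set of points of $S$ of the form $f(x)$, where $x \in X$ is a point such that the residue field extension $\kappa(f(x)) \subset \kappa(x)$ is purely inseparable (resp. trivial). A scheme $S$ is called a Poonen scheme (resp. a strict Poonen scheme) if for every nonempty open subscheme $U \subset S$ and every dominant morphism $f : X \to U$ of finite presentation, the set $\mathrm{QRel}(f)$ (resp. $\mathrm{Rel}(f)$) is nonempty. Let $S$ be an integral Poonen scheme whose function field is perfect. Then $S$ is a strict Poonen scheme. -/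

import Mathlib

open CategoryTheory

universe u

namespace AlgebraicGeometry.Scheme

/-- The points `x` of `X` such that the residue field extension `κ(f x) → κ(x)` is purely
inseparable (`radicielle`). -/
def qrelTilde {X S : Scheme.{u}} (f : X ⟶ S) : Set X :=
  {x | (f.residueFieldMap x).hom.IsPurelyInseparable}

/-- The points `x` of `X` such that the residue field extension `κ(f x) → κ(x)` is trivial. -/
def relTilde {X S : Scheme.{u}} (f : X ⟶ S) : Set X :=
  {x | Function.Bijective (f.residueFieldMap x).hom}

/-- `QRel(f)`: the set of points of `S` which can be quasi-lifted to `X`. -/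
def QRel {X S : Scheme.{u}} (f : X ⟶ S) : Set S := (fun x : X => f x) '' qrelTilde f

/-- `Rel(f)`: the set of points of `S` which can be lifted to `X`. -/
def Rel {X S : Scheme.{u}} (f : X ⟶ S) : Set S := (fun x : X => f x) '' relTilde f

/-- A morphism of schemes is of finite presentation if it is locally of finite presentation,
quasi-compact and quasi-separated. -/
structure IsOfFinitePresentation {X S : Scheme.{u}} (f : X ⟶ S) : Prop where
  locallyOfFinitePresentation : LocallyOfFinitePresentation f
  quasiCompact : QuasiCompact f
  quasiSeparated : QuasiSeparated f

/-- `S` is a Poonen scheme: for every nonempty open `U` of `S` and every dominant morphism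
`f : X ⟶ U` of finite presentation, `QRel(f)` is nonempty. -/
def IsPoonen (S : Scheme.{u}) : Prop :=
  ∀ U : S.Opens, (U : Set S).Nonempty →
    ∀ (X : Scheme.{u}) (f : X ⟶ U.toScheme),
      IsOfFinitePresentation f → IsDominant f → (QRel f).Nonempty

/-- `S` is a strict Poonen scheme: for every nonempty open `U` of `S` and every dominant morphism
`f : X ⟶ U` of finite presentation, `Rel(f)` is nonempty. -/
def IsStrictPoonen (S : Scheme.{u}) : Prop :=
  ∀ U : S.Opens, (U : Set S).Nonempty →
    ∀ (X : Scheme.{u}) (f : X ⟶ U.toScheme),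
      IsOfFinitePresentation f → IsDominant f → (Rel f).Nonempty

end AlgebraicGeometry.Scheme

/-! A dominant quasi-compact `f` hits the generic point. A closed point of an affine piece of the
generic fibre has residue field finite over the function field, hence separable by perfectness. It
spreads out to a dominant étale `h : Y ⟶ V` with a lift `g : Y ⟶ X` (`exists_etale_lift`, resting on
`exists_etale_algHom_of_finiteType`). The Poonen property for `h` gives `y` with purely inseparable
residue extension; étaleness makes it separable too, hence trivial. The residue field of `g y` lies
in between, so its extension is trivial as well. -/

open Polynomial in
/-- A standard étale algebra `R[X, 1/g]/(f)` embeds into any field extension of `Frac R` generated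
by a root of `f` whose minimal polynomial is the image of `f`. -/
lemma StandardEtalePair.lift_injective {R K L : Type*} [CommRing R] [Field K] [Field L]
    [Algebra R K] [FaithfulSMul R K] [Algebra K L] [Algebra R L] [IsScalarTower R K L]
    (P : StandardEtalePair R) (x : L) (hx : P.HasMap x)
    (hf : P.f.map (algebraMap R K) = minpoly K x) :
    Function.Injective (P.lift x hx) := by
  rw [injective_iff_map_eq_zero]
  intro z hz
  let E : StandardEtalePresentation R P.Ring := ⟨P, P.X, P.hasMap_X, by
    rw [P.lift_X_left]; exact Function.bijective_id⟩
  obtain ⟨p, n, hp⟩ := E.exists_mul_aeval_x_g_pow_eq_aeval_x z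
  change z * aeval P.X P.g ^ _ = aeval P.X _ at hp
  have h0 : aeval x p = 0 := by
    rw [← P.lift_X x hx, aeval_algHom_apply, ← hp, map_mul, hz, zero_mul]
  -- Since `P.f` is monic, divisibility descends from `K[X]` to `R[X]`.
  have hdvd : P.f ∣ p := by
    rw [← Polynomial.map_dvd_map _ (FaithfulSMul.algebraMap_injective R K) P.monic_f, hf]
    exact minpoly.dvd K x (by rwa [aeval_map_algebraMap])
  obtain ⟨q, rfl⟩ := hdvd
  rw [map_mul, P.hasMap_X.1, zero_mul] at hp
  exact ((P.hasMap_X.2.pow _).mul_left_eq_zero).mp hp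

open Polynomial in
/-- A finite separable extension of the fraction field of a domain `A` is generated by an element
whose minimal polynomial has coefficients in `A`. -/
lemma exists_adjoin_eq_top_minpoly_eq_map (A K L : Type*) [CommRing A] [IsDomain A] [Field K]
    [Algebra A K] [IsFractionRing A K] [Field L] [Algebra K L] [FiniteDimensional K L]
    [Algebra.IsSeparable K L] :
    ∃ (x : L) (f : A[X]), f.Monic ∧ f.map (algebraMap A K) = minpoly K x ∧
      Algebra.adjoin K {x} = ⊤ := by
  obtain ⟨t, ht⟩ := Field.exists_primitive_element K L
  have hint : IsIntegral K t := .of_finite K t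
  -- Multiplying the primitive element by a common denominator `d` clears the denominators of its
  -- minimal polynomial.
  obtain ⟨d, hd⟩ : ∃ d : nonZeroDivisors A,
      (minpoly K t).scaleRoots (algebraMap A K d) ∈ lifts (algebraMap A K) :=
    ⟨_, IsLocalization.scaleRoots_commonDenom_mem_lifts (nonZeroDivisors A) (minpoly K t)
      (by rw [minpoly.monic hint]; exact one_mem _)⟩
  have hd0 : algebraMap A K d ≠ 0 := IsFractionRing.to_map_ne_zero_of_mem_nonZeroDivisors d.2
  have hmon : ((minpoly K t).scaleRoots (algebraMap A K d)).Monic :=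
    (monic_scaleRoots_iff _).mpr (minpoly.monic hint)
  obtain ⟨f, hf, -, hfm⟩ := lifts_and_degree_eq_and_monic hd hmon
  have htop : IntermediateField.adjoin K {algebraMap K L (algebraMap A K d) * t} = ⊤ := by
    rw [eq_top_iff, ← ht, IntermediateField.adjoin_simple_le_iff]
    have h1 := IntermediateField.mem_adjoin_simple_self K (algebraMap K L (algebraMap A K d) * t)
    have h2 := mul_mem (IntermediateField.algebraMap_mem
      (IntermediateField.adjoin K {algebraMap K L (algebraMap A K d) * t})
        (algebraMap A K d)⁻¹) h1
    rwa [← mul_assoc, ← map_mul, inv_mul_cancel₀ hd0, map_one, one_mul] at h2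
  have hint' : IsIntegral K (algebraMap K L (algebraMap A K d) * t) := .of_finite K _
  refine ⟨algebraMap K L (algebraMap A K d) * t, f, hfm, ?_, ?_⟩
  · rw [hf]
    refine minpoly.unique_of_degree_le_degree_minpoly K _ hmon
      (scaleRoots_aeval_eq_zero (minpoly.aeval K t)) ?_
    rw [degree_scaleRoots, degree_eq_natDegree (minpoly.ne_zero hint),
      degree_eq_natDegree (minpoly.ne_zero hint'),
      (Field.primitive_element_iff_minpoly_natDegree_eq K _).mp ht,
      (Field.primitive_element_iff_minpoly_natDegree_eq K _).mp htop]
  · rw [← IntermediateField.adjoin_simple_toSubalgebra_of_isAlgebraic hint'.isAlgebraic, htop,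
      IntermediateField.top_toSubalgebra]

open Polynomial TensorProduct in
/-- A finite type algebra `B ⊇ A` over a domain `A` with perfect fraction field admits an `A`-algebra
map to an étale `A`-algebra containing `A`. -/
lemma exists_etale_algHom_of_finiteType {A B : Type u} (K : Type u) [CommRing A] [IsDomain A]
    [Field K] [PerfectField K] [Algebra A K] [IsFractionRing A K] [CommRing B] [Algebra A B]
    [Algebra.FiniteType A B] [FaithfulSMul A B] :
    ∃ (C : Type u) (_ : CommRing C) (_ : Algebra A C), Algebra.Etale A C ∧ FaithfulSMul A C ∧
      Nonempty (B →ₐ[A] C) := by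
  have : Module.Flat A K := IsLocalization.flat K (nonZeroDivisors A)
  have : Nontrivial (K ⊗[A] B) :=
    Algebra.TensorProduct.nontrivial_of_algebraMap_injective_of_flat_left A K B
      (FaithfulSMul.algebraMap_injective A B)
  -- By the Nullstellensatz the residue field `L` is finite over `K`.
  obtain ⟨m, hm⟩ := Ideal.exists_maximal (K ⊗[A] B)
  let L := (K ⊗[A] B) ⧸ m
  let : Field L := Ideal.Quotient.field m
  have : Module.Finite K L := finite_of_finite_type_of_isJacobsonRing K L
  obtain ⟨x, f, hfm, hf, hx⟩ := exists_adjoin_eq_top_minpoly_eq_map A K L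
  let φ : B →ₐ[A] L := (Ideal.Quotient.mkₐ A m).comp Algebra.TensorProduct.includeRight
  have hden (b : L) : ∃ a : A, a ≠ 0 ∧ ∃ p : A[X], aeval x p = algebraMap A L a * b := by
    have hb : b ∈ Algebra.adjoin K {x} := hx ▸ Algebra.mem_top
    rw [Algebra.adjoin_singleton_eq_range_aeval] at hb
    obtain ⟨q, rfl⟩ := hb
    obtain ⟨a, ha0, ha⟩ := IsLocalization.integerNormalization_spec (nonZeroDivisors A) q
    refine ⟨a, nonZeroDivisors.ne_zero ha0,
      IsLocalization.integerNormalization (nonZeroDivisors A) q, ?_⟩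
    rw [← aeval_map_algebraMap K, ha]
    simp [Algebra.smul_def, IsScalarTower.algebraMap_apply A K L]
  choose den hden0 num hnum using hden
  obtain ⟨s, hs⟩ := Algebra.FiniteType.out (R := A) (A := B)
  let a := ∏ b ∈ s, den (φ b)
  have ha : a ≠ 0 := Finset.prod_ne_zero_iff.mpr fun b _ ↦ hden0 _
  -- Inverting `f'` makes the algebra étale; inverting `a` makes it contain the images of the
  -- generators of `B`.
  let P : StandardEtalePair A := ⟨f, hfm, C a * derivative f, C a, 0, 1, by ring⟩
  have hinj : Function.Injective (algebraMap A L) := by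
    rw [IsScalarTower.algebraMap_eq A K L]
    exact (algebraMap K L).injective.comp (IsFractionRing.injective A K)
  have hP : P.HasMap x := by
    refine ⟨?_, ?_⟩
    · rw [← aeval_map_algebraMap K, hf, minpoly.aeval]
    · have := (Algebra.IsSeparable.isSeparable K x).aeval_derivative_ne_zero (minpoly.aeval K x)
      rw [← hf, derivative_map, aeval_map_algebraMap] at this
      simpa [P, (map_eq_zero_iff _ hinj).not.mpr ha] using this
  have hl := P.lift_injective x hP hf
  have hr : φ.range ≤ (P.lift x hP).range := by
    rw [← Algebra.map_top, ← hs, AlgHom.map_adjoin, Algebra.adjoin_le_iff]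
    rintro _ ⟨b, hb, rfl⟩
    obtain ⟨c, hc : a = _⟩ := Finset.dvd_prod_of_mem (fun b ↦ den (φ b)) hb
    have hu : IsUnit (algebraMap A P.Ring a) := by
      have := P.hasMap_X.2
      simp only [P, map_mul, aeval_C] at this
      exact isUnit_of_mul_isUnit_left this
    obtain ⟨v, hv⟩ := hu.exists_left_inv
    refine ⟨v * algebraMap A P.Ring c * aeval P.X (num (φ b)), ?_⟩
    have hv' := congr(P.lift x hP $hv)
    simp only [map_mul, map_one, AlgHom.commutes] at hv'
    change P.lift x hP _ = φ b
    rw [map_mul, map_mul, ← aeval_algHom_apply, P.lift_X, hnum, AlgHom.commutes]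
    rw [hc, map_mul] at hv'
    linear_combination φ b * hv'
  refine ⟨P.Ring, inferInstance, inferInstance, inferInstance, ?_, ⟨?_⟩⟩
  · rw [faithfulSMul_iff_algebraMap_injective]
    refine .of_comp (f := P.lift x hP) ?_
    convert hinj
    ext; simp
  · exact (AlgEquiv.ofInjective _ hl).symm.toAlgHom.comp
      ((Subalgebra.inclusion hr).comp φ.rangeRestrict)

namespace AlgebraicGeometry.Scheme

lemma qrelTilde_subset_relTilde_of_etale {X Y : Scheme.{u}} (f : X ⟶ Y) [Etale f] :
    qrelTilde f ⊆ relTilde f := by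
  intro x (hx : (f.residueFieldMap x).hom.IsPurelyInseparable)
  algebraize [(f.residueFieldMap x).hom]
  exact IsPurelyInseparable.bijective_algebraMap_of_isSeparable _ _

/-- Maps of fields are injective, so a surjective composite forces both factors to be bijective. -/
lemma mem_relTilde_comp {X Y Z : Scheme.{u}} (f : X ⟶ Y) (g : Y ⟶ Z) {x : X} :
    x ∈ relTilde (f ≫ g) ↔ f x ∈ relTilde g ∧ x ∈ relTilde f := by
  have h : x ∈ relTilde (f ≫ g) ↔ Function.Bijective
      ((f.residueFieldMap x).hom ∘ (g.residueFieldMap (f x)).hom) := by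
    rw [relTilde, Set.mem_ofPred_eq, residueFieldMap_comp]
    rfl
  rw [h]
  refine ⟨fun h ↦ ?_, fun h ↦ h.2.comp h.1⟩
  have h2 : Function.Bijective (f.residueFieldMap x).hom :=
    ⟨RingHom.injective _, h.2.of_comp⟩
  exact ⟨(Function.Bijective.of_comp_iff' h2 _).mp h, h2⟩

lemma mem_relTilde_of_isOpenImmersion {X Y : Scheme.{u}} (f : X ⟶ Y) [IsOpenImmersion f] (x : X) :
    x ∈ relTilde f :=
  ConcreteCategory.bijective_of_isIso (f.residueFieldMap x)

/-- A quasi-compact source is covered by one affine scheme, and a dominant map of affine schemes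
hits every minimal prime. -/
lemma genericPoint_mem_range_of_isAffine {X Y : Scheme.{u}} [IsIntegral Y] [IsAffine Y] (f : X ⟶ Y)
    [QuasiCompact f] [IsDominant f] : genericPoint Y ∈ Set.range f := by
  have := QuasiCompact.compactSpace_of_compactSpace f
  obtain ⟨R, g, hg⟩ := compactSpace_iff_exists.mp this
  have : Surjective g := ⟨hg⟩
  obtain ⟨φ, hφ⟩ := Spec.map_surjective (g ≫ f ≫ Y.isoSpec.hom)
  have hd : DenseRange (Spec.map φ) := by
    rw [hφ]
    exact Hom.denseRange _
  obtain ⟨r, hr⟩ := (PrimeSpectrum.denseRange_comap_iff_minimalPrimes _).mp hd ⊥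
    (by rw [IsDomain.minimalPrimes_eq_singleton_bot]; rfl)
  have hr' : (g ≫ f ≫ Y.isoSpec.hom) r = Y.isoSpec.hom (genericPoint Y) := by
    rw [← hφ, genericPoint_eq_of_isOpenImmersion, genericPoint_eq_bot_of_affine]
    exact hr
  exact ⟨g r, Y.isoSpec.hom.homeomorph.injective hr'⟩

lemma genericPoint_mem_range {X Y : Scheme.{u}} [IsIntegral Y] (f : X ⟶ Y)
    [QuasiCompact f] [IsDominant f] : genericPoint Y ∈ Set.range f := by
  obtain ⟨_, ⟨V, hV, rfl⟩, hηV, -⟩ := Y.isBasis_affineOpens.exists_subset_of_mem_open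
    (Set.mem_univ (genericPoint Y)) isOpen_univ
  have : Nonempty V := ⟨_, hηV⟩
  have : IsAffine V := hV
  have : IsDominant (f ∣_ V) := IsZariskiLocalAtTarget.restrict ‹_› V
  obtain ⟨x, hx⟩ := genericPoint_mem_range_of_isAffine (f ∣_ V)
  refine ⟨(f ⁻¹ᵁ V).ι x, ?_⟩
  rw [← Hom.comp_apply, ← morphismRestrict_ι, Hom.comp_apply, hx,
    genericPoint_eq_of_isOpenImmersion]

lemma appLE_injective_of_apply_eq_genericPoint {X S : Scheme.{u}} [IsIntegral S] (f : X ⟶ S)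
    {x : X} (hx : f x = genericPoint S) {V : S.Opens} {W : X.Opens} (hVW : W ≤ f ⁻¹ᵁ V)
    (hxW : x ∈ W) : Function.Injective (f.appLE V W hVW).hom := by
  -- The stalk at the generic point is a field, so the stalk map out of it is injective.
  have hfield : IsField (S.presheaf.stalk (f x)) := hx ▸ Field.toIsField S.functionField
  let := hfield.toField
  have h1 : Function.Injective (S.presheaf.germ V (f x) (hVW hxW)) :=
    germ_injective_of_isIntegral _ _ _
  have h2 : Function.Injective (f.stalkMap x).hom := RingHom.injective _
  have h : f.appLE V W hVW ≫ X.presheaf.germ W x hxW =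
      S.presheaf.germ V (f x) (hVW hxW) ≫ f.stalkMap x := by
    refine Eq.trans ?_ (Hom.germ_stalkMap f V x _).symm
    simp [Hom.appLE]
  refine Function.Injective.of_comp (f := X.presheaf.germ W x hxW) ?_
  have h3 := h2.comp h1
  convert h3
  ext a
  exact congr($h a)

/-- A morphism locally of finite type hitting the generic point of an integral scheme with perfect
function field has a section over a dominant étale scheme over some affine open. -/
lemma exists_etale_lift {X S : Scheme.{u}} [IsIntegral S] [PerfectField S.functionField]
    (f : X ⟶ S) [LocallyOfFiniteType f] (hf : genericPoint S ∈ Set.range f) :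
    ∃ (V : S.Opens) (Y : Scheme.{u}) (h : Y ⟶ V.toScheme) (g : Y ⟶ X),
      (V : Set S).Nonempty ∧ Etale h ∧ QuasiCompact h ∧ QuasiSeparated h ∧ IsDominant h ∧
        g ≫ f = h ≫ V.ι := by
  obtain ⟨x, hx⟩ := hf
  obtain ⟨_, ⟨V, hV, rfl⟩, hxV, -⟩ := S.isBasis_affineOpens.exists_subset_of_mem_open
    (Set.mem_univ (f x)) isOpen_univ
  obtain ⟨_, ⟨W, hW, rfl⟩, hxW, hWV⟩ := X.isBasis_affineOpens.exists_subset_of_mem_open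
    (show x ∈ f ⁻¹ᵁ V from hxV) (f ⁻¹ᵁ V).isOpen
  have : Nonempty V := ⟨_, hxV⟩
  have hinj := appLE_injective_of_apply_eq_genericPoint f hx (V := V) hWV hxW
  have hft : (f.appLE V W hWV).hom.FiniteType := f.finiteType_appLE hV hW hWV
  have := functionField_isFractionRing_of_isAffineOpen S V hV
  algebraize [(f.appLE V W hWV).hom]
  have : FaithfulSMul Γ(S, V) Γ(X, W) := (faithfulSMul_iff_algebraMap_injective _ _).mpr hinj
  obtain ⟨C, _, _, _, _, ⟨ψ⟩⟩ :=
    exists_etale_algHom_of_finiteType (A := Γ(S, V)) (B := Γ(X, W)) S.functionField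
  let i : Γ(S, V) ⟶ .of C := CommRingCat.ofHom (algebraMap Γ(S, V) C)
  have hi : f.appLE V W hWV ≫ CommRingCat.ofHom ψ.toRingHom = i := by
    ext a
    exact ψ.commutes a
  have het : Etale (Spec.map i) := by
    rw [HasRingHomProperty.Spec_iff (P := @Etale)]
    exact RingHom.etale_algebraMap.mpr inferInstance
  have hdom : IsDominant (Spec.map i) := by
    refine ⟨(PrimeSpectrum.denseRange_comap_iff_ker_le_nilRadical _).mpr ?_⟩
    exact ((RingHom.injective_iff_ker_eq_bot _).mp
      (FaithfulSMul.algebraMap_injective Γ(S, V) C)).trans_le bot_le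
  refine ⟨V, Spec (.of C), Spec.map i ≫ hV.isoSpec.inv,
    Spec.map (CommRingCat.ofHom ψ.toRingHom) ≫ hW.fromSpec, ⟨_, hxV⟩, inferInstance,
    inferInstance, inferInstance, inferInstance, ?_⟩
  rw [Category.assoc, ← hV.SpecMap_appLE_fromSpec f hW hWV, ← Spec.map_comp_assoc, hi,
    Category.assoc, hV.isoSpec_inv_ι]

end AlgebraicGeometry.Scheme

open AlgebraicGeometry Scheme in
theorem proposition4p4p1 (S : AlgebraicGeometry.Scheme.{u}) [AlgebraicGeometry.IsIntegral S]
    (hS : S.IsPoonen) (hK : PerfectField S.functionField) :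
    S.IsStrictPoonen := by
  intro U hU X f ⟨_, _, _⟩ _
  have : Nonempty U := hU.to_subtype
  obtain ⟨x, hx⟩ := genericPoint_mem_range f
  obtain ⟨V, Y, h, g, hV, _, hqc, hqs, hdom, hgf⟩ := exists_etale_lift (f ≫ U.ι)
    ⟨x, by rw [Hom.comp_apply, hx, genericPoint_eq_of_isOpenImmersion]⟩
  obtain ⟨_, y, hy, -⟩ := hS V hV Y h ⟨inferInstance, hqc, hqs⟩ hdom
  have hy' : y ∈ relTilde (g ≫ f ≫ U.ι) := by
    rw [hgf, mem_relTilde_comp]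
    exact ⟨mem_relTilde_of_isOpenImmersion _ _, qrelTilde_subset_relTilde_of_etale h hy⟩
  rw [mem_relTilde_comp, mem_relTilde_comp] at hy'
  exact ⟨_, g y, hy'.1.2, rfl⟩
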